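/- Let $k$ be an algebraically closed field of characteristic $0$, let $W^\vee=\{x\in k^6 : \sum_{i=0}^5 x_i=0\}$, and let $W$ be its dual space. Let $S_3\subset\mathbb{P}(W^\vee)\cong\mathbb{P}^4$ be the Segre cubic, given by $\sum_{i=0}^5 x_i^3=0$. Let $p_1,\dots,p_{10}$ be its nodes, i.e. the points of the orbit of $(1:1:1:-1:-1:-1)$ under the permutations of the six coordinates. Each point $h\in\mathbb{P}(W)$ can be written uniquely as $(a_0:\dots:a_5)$ with $\sum_i a_i=0$, and corresponds to the hyperplane $H=\{x\in\mathbb{P}(W^\vee):\sum_i a_ix_i=0\}$. Let $P_i\subset\mathbb{P}(W)$ be the set of those $h$ whose hyperplane $H$ contains $p_i$, and let $\mathcal{I}_4\subset\mathbb{P}(W)$ be the Castelnuovo–Richmond quartic, given by $\left(\sum_i a_i^2\right)^2-4\sum_i a_i^4=0$. **Lemma.** Let $h\in\mathbb{P}(W)$ and let $H\subset\mathbb{P}(W^\vee)$ be the dual hyperplane. The hyperplane section $H\cap S_3$ is a one-nodal cubic surface (a cubic surface in $H\cong\mathbb{P}^3$ with exactly one singular point, that point being a node, i.e. an ordinary double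 point) if and only if either $$h\in P_i\setminus\Big(\mathcal{I}_4\cup\bigcup_{j\neq i}P_j\Big)\ \text{ for some } i\in\{1,\dots,10\},\qquad\text{or}\qquad h\in\mathcal{I}_4\setminus\bigcup_{i=1}^{10}P_i .$$ -/

import Mathlib

/-!
Let `L` be the space of vectors `x` with `∑ i, x i = 0` and `∑ i, a i * x i = 0`. The orthogonal
space of `L` is spanned by `1` and `a`, so `x ∈ L` is singular for `∑ i, x i ^ 3` on `L` if and only
if `x i ^ 2 = l + m * a i` for some scalars `l` and `m`, and a vector `v ∈ L` lies in the radical of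
the Hessian at `x` if and only if `x i * v i` is likewise affine in `a i`.

If `m = 0`, then `x` is proportional to a vector `n` with coordinates `±1`, which is a node of the
Segre cubic. The vectors `v` with `n * v` affine in `a` are spanned by `n` and `a * n`, so
`n` is a node of the section if and only if `∑ i, a i ^ 2 * n i ≠ 0`; and on the hyperplane
`∑ i, a i * n i = 0` the quartic form is minus the square of this sum.

If `m ≠ 0`, the sextic `∏ i, (t - x i)` has no term in `t ^ 3` because `∑ i, x i ^ 3 = 0`. It
therefore expresses the fifth elementary symmetric function `e₅` of `x` times `x i` as a cubic
polynomial in `x i ^ 2`, that is, in `a i`, and comparing coefficients shows that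
`m ^ 3 * q (a i) = e₅ * x i`, where `q` is the polynomial part of the square root of
`∏ i, (t - a i)`. Hence up to scalars `x` can only be the vector `y` with coordinates `q (a i)`.
Since `∑ i, a i * q (a i)` is a multiple of the quartic form, `y` lies in `L` exactly over the
quartic. There `∏ i, (t - a i) = q ^ 2 - (α * t + β)`, which makes `y` singular, and `y = 0` would
give `∏ i, (t - a i) = q ^ 2`, so that some node of the Segre cubic would lie on the hyperplane. If
none does, then `e₅ ≠ 0` for `x = y`, which forces the Hessian to be nondegenerate at `y`.
-/

open scoped LinearAlgebra.Projectivization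

noncomputable section

namespace ProjHypersurface

variable {k : Type*} [Field k] {n : ℕ}

/-- The first derivative of the polynomial `F` at `x` in the direction `v`. -/
def dirDeriv (F : MvPolynomial (Fin n) k) (x v : Fin n → k) : k :=
  ∑ i, v i * MvPolynomial.eval x (MvPolynomial.pderiv i F)

/-- The second derivative (Hessian bilinear form) of the polynomial `F` at `x`
in the directions `v` and `w`. -/
def hessian (F : MvPolynomial (Fin n) k) (x v w : Fin n → k) : k :=
  ∑ i, ∑ j, v i * w j * MvPolynomial.eval x (MvPolynomial.pderiv j (MvPolynomial.pderiv i F))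

/-- The point `p` of the projective space `ℙ(L)`, where `L` is a linear subspace of `k ^ n`, is a
singular point of the hypersurface (as a scheme) of `ℙ(L)` cut out by the homogeneous
polynomial `F`: both `F|_L` and the differential of `F|_L` vanish at `p`. -/
def IsSingularAt (F : MvPolynomial (Fin n) k) (L : Submodule k (Fin n → k)) (p : ℙ k L) : Prop :=
  MvPolynomial.eval (p.rep : Fin n → k) F = 0 ∧
    ∀ v ∈ L, dirDeriv F (p.rep : Fin n → k) v = 0

/-- The point `p` of `ℙ(L)` is a node (ordinary double point) of the hypersurface of `ℙ(L)` cut out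
by the homogeneous polynomial `F`: it is a singular point, and the Hessian of `F|_L` at `p = [x]`,
which by singularity of `p` (and Euler's relation) descends to the tangent space `L / k x`
of `ℙ(L)` at `p`, is nondegenerate there.
Equivalently, on an affine chart around `p`, given by a complement `M` of the line `k x` in `L`,
the quadratic part of the local equation `m ↦ F (x + m)` is a nondegenerate quadratic form
(in characteristic different from two). -/
def IsNodeAt (F : MvPolynomial (Fin n) k) (L : Submodule k (Fin n → k)) (p : ℙ k L) : Prop :=
  IsSingularAt F L p ∧
    ∀ v ∈ L, (∀ w ∈ L, hessian F (p.rep : Fin n → k) v w = 0) →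
      v ∈ Submodule.span k {(p.rep : Fin n → k)}

/-- The hypersurface of `ℙ(L)` cut out by `F` is a one-nodal cubic surface: `ℙ(L)` is a projective
`3`-space, `F|_L` is a nonzero cubic form, and the surface has exactly one singular point,
which is a node. -/
structure IsOneNodalCubicSurface (F : MvPolynomial (Fin n) k)
    (L : Submodule k (Fin n → k)) : Prop where
  finrank_eq : Module.finrank k L = 4
  homogeneous : F.IsHomogeneous 3
  not_vanishing : ∃ x ∈ L, MvPolynomial.eval x F ≠ 0
  existsUnique_node : ∃ p : ℙ k L, IsNodeAt F L p ∧ ∀ q : ℙ k L, IsSingularAt F L q → q = p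

end ProjHypersurface

namespace SegreCubic

/-- The five-dimensional space `{x ∈ k ^ 6 | ∑ i, x i = 0}`, whose projectivization `ℙ ^ 4`
contains the Segre cubic. It is the space written `W^∨` in the classical setting, so that the
dual projective space `ℙ(W)` of its hyperplanes is `ℙ k (Module.Dual k (Wdual k))`. -/
def Wdual (k : Type*) [Field k] : Submodule k (Fin 6 → k) where
  carrier := {x | ∑ i, x i = 0}
  add_mem' {x y} hx hy := by
    change ∑ i, x i = 0 at hx
    change ∑ i, y i = 0 at hy
    change ∑ i, (x + y) i = 0
    simp [Finset.sum_add_distrib, hx, hy]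
  zero_mem' := by simp
  smul_mem' c x hx := by
    change ∑ i, x i = 0 at hx
    change ∑ i, (c • x) i = 0
    simp [← Finset.mul_sum, hx]

variable {k : Type*} [Field k]

theorem mem_Wdual {x : Fin 6 → k} : x ∈ Wdual k ↔ ∑ i, x i = 0 := Iff.rfl

/-- The cubic form `∑ i, x i ^ 3`. The Segre cubic is the hypersurface
of `ℙ k (Wdual k)` that it cuts out. -/
def segreForm (k : Type*) [Field k] : MvPolynomial (Fin 6) k :=
  ∑ i, MvPolynomial.X i ^ 3

/-- The linear subspace `L ⊆ Wdual k ⊆ k ^ 6` of codimension one in `Wdual k` for which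
`H = ℙ(L)` is the hyperplane of `ℙ k (Wdual k)` dual to the point `h` of the dual projective space:
the kernel of the linear functional `h`.
The hyperplane section of the Segre cubic by `H` is the hypersurface
of `ℙ(L)` cut out by `segreForm k`. -/
def hyperplane (h : ℙ k (Module.Dual k (Wdual k))) : Submodule k (Fin 6 → k) :=
  (LinearMap.ker h.rep).map (Wdual k).subtype

/-- The vector `(1, 1, 1, -1, -1, -1)` with its coordinates permuted by `σ`. -/
def nodeVector (k : Type*) [Field k] (σ : Equiv.Perm (Fin 6)) : Wdual k :=
  ⟨fun i => (![1, 1, 1, -1, -1, -1] : Fin 6 → k) (σ i), by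
    rw [mem_Wdual, Equiv.sum_comp σ (![1, 1, 1, -1, -1, -1] : Fin 6 → k)]
    simp [Fin.sum_univ_six]⟩

theorem nodeVector_ne_zero (σ : Equiv.Perm (Fin 6)) : nodeVector k σ ≠ 0 := by
  intro h
  have h0 := congrFun (congrArg Subtype.val h) (σ.symm 0)
  simp [nodeVector] at h0

/-- The set of the ten nodes of the Segre cubic: the orbit of the point `(1 : 1 : 1 : -1 : -1 : -1)`
under the permutations of the six coordinates. -/
def nodes (k : Type*) [Field k] : Set (ℙ k (Wdual k)) :=
  Set.range fun σ : Equiv.Perm (Fin 6) =>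
    Projectivization.mk k (nodeVector k σ) (nodeVector_ne_zero σ)

/-- The hyperplane of the dual projective space formed by the hyperplanes of `ℙ k (Wdual k)`
which contain the point `p`. For the ten nodes `p` these are the
hyperplanes `P_1, …, P_10`. -/
def dualHyperplane (p : ℙ k (Wdual k)) : Set (ℙ k (Module.Dual k (Wdual k))) :=
  {h | h.rep p.rep = 0}

variable [CharZero k]

/-- The projection of the `i`-th standard basis vector to `Wdual k`,
along the line spanned by `(1, 1, 1, 1, 1, 1)`. -/
def projBasis (k : Type*) [Field k] [CharZero k] (i : Fin 6) : Wdual k :=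
  ⟨fun j => (if j = i then 1 else 0) - 1 / 6, by
    rw [mem_Wdual]
    simp [Finset.sum_sub_distrib]⟩

/-- The six coordinates, with sum zero, of a linear functional on `Wdual k`. -/
def dualCoord (φ : Module.Dual k (Wdual k)) (i : Fin 6) : k := φ (projBasis k i)

/-- The coordinates of a functional have sum zero. -/
theorem sum_dualCoord (φ : Module.Dual k (Wdual k)) : ∑ i, dualCoord φ i = 0 := by
  have h : ∑ i, projBasis k i = 0 := by
    ext j
    simp [projBasis, Finset.sum_sub_distrib]
  simp only [dualCoord, ← map_sum, h, map_zero]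

/-- The functional with coordinates `a` is `x ↦ ∑ i, a i * x i`. -/
theorem apply_eq_sum_dualCoord (φ : Module.Dual k (Wdual k)) (x : Wdual k) :
    φ x = ∑ i, dualCoord φ i * (x : Fin 6 → k) i := by
  have hx : ∑ i, (x : Fin 6 → k) i = 0 := x.2
  have h : x = ∑ i, (x : Fin 6 → k) i • projBasis k i := by
    ext j
    simp [projBasis, mul_sub, Finset.sum_sub_distrib, ← Finset.sum_mul, hx]
  conv_lhs => rw [h]
  simp [dualCoord, mul_comm]

/-- The Castelnuovo–Richmond quartic in the dual projective space, whose points are described by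
six coordinates `a i` with sum zero (the hyperplane `∑ i, a i * x i = 0` of `ℙ k (Wdual k)`):
the locus where `(∑ i, a i ^ 2) ^ 2 - 4 * ∑ i, a i ^ 4 = 0`. -/
def castelnuovoRichmondQuartic (k : Type*) [Field k] [CharZero k] :
    Set (ℙ k (Module.Dual k (Wdual k))) :=
  {h | (∑ i, dualCoord h.rep i ^ 2) ^ 2 - 4 * ∑ i, dualCoord h.rep i ^ 4 = 0}

end SegreCubic

end

namespace ProjHypersurface

section Homogeneous

variable {k : Type*} [Field k] {n d : ℕ} {F : MvPolynomial (Fin n) k} {L : Submodule k (Fin n → k)}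

/-- `x` is a vector at which both `F|_L` and its differential vanish: for `x ∈ L` nonzero, this says
that the point `[x]` of `ℙ(L)` is a singular point of the hypersurface cut out by `F`. -/
def IsSingularVector (F : MvPolynomial (Fin n) k) (L : Submodule k (Fin n → k))
    (x : Fin n → k) : Prop :=
  MvPolynomial.eval x F = 0 ∧ ∀ v ∈ L, dirDeriv F x v = 0

/-- The radical of the Hessian of `F|_L` at `x` is contained in the line spanned by `x`. -/
def IsNondegenerateVector (F : MvPolynomial (Fin n) k) (L : Submodule k (Fin n → k))
    (x : Fin n → k) : Prop :=
  ∀ v ∈ L, (∀ w ∈ L, hessian F x v w = 0) → v ∈ Submodule.span k {x}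

theorem eval_smul_of_isHomogeneous (hF : F.IsHomogeneous d) (c : k) (x : Fin n → k) :
    MvPolynomial.eval (c • x) F = c ^ d * MvPolynomial.eval x F := by
  simp only [MvPolynomial.eval_eq, Finset.mul_sum, Pi.smul_apply, smul_eq_mul, mul_pow,
    Finset.prod_mul_distrib, Finset.prod_pow_eq_pow_sum]
  refine Finset.sum_congr rfl fun m hm => ?_
  rw [← hF.degree_eq_sum_deg_support hm, mul_left_comm]

theorem dirDeriv_smul_of_isHomogeneous (hF : F.IsHomogeneous d) (c : k) (x v : Fin n → k) :
    dirDeriv F (c • x) v = c ^ (d - 1) * dirDeriv F x v := by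
  simp only [dirDeriv, eval_smul_of_isHomogeneous hF.pderiv, Finset.mul_sum, mul_left_comm]

theorem hessian_smul_of_isHomogeneous (hF : F.IsHomogeneous d) (c : k) (x v w : Fin n → k) :
    hessian F (c • x) v w = c ^ (d - 1 - 1) * hessian F x v w := by
  simp only [hessian, eval_smul_of_isHomogeneous hF.pderiv.pderiv, Finset.mul_sum, mul_left_comm]

theorem isSingularVector_smul_iff (hF : F.IsHomogeneous d) {c : k} (hc : c ≠ 0)
    {x : Fin n → k} : IsSingularVector F L (c • x) ↔ IsSingularVector F L x := by
  simp [IsSingularVector, eval_smul_of_isHomogeneous hF, dirDeriv_smul_of_isHomogeneous hF, hc]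

theorem isNondegenerateVector_smul_iff (hF : F.IsHomogeneous d) {c : k} (hc : c ≠ 0)
    {x : Fin n → k} : IsNondegenerateVector F L (c • x) ↔ IsNondegenerateVector F L x := by
  simp [IsNondegenerateVector, hessian_smul_of_isHomogeneous hF, hc,
    Submodule.span_singleton_smul_eq hc.isUnit]

theorem exists_mk_rep_eq_smul {x : L} (hx : x ≠ 0) :
    ∃ c : k, c ≠ 0 ∧ ((Projectivization.mk k x hx).rep : Fin n → k) = c • (x : Fin n → k) := by
  obtain ⟨c, hc⟩ := Projectivization.exists_smul_eq_mk_rep k x hx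
  exact ⟨c, c.ne_zero, congrArg Subtype.val hc.symm⟩

theorem isSingularAt_mk_iff (hF : F.IsHomogeneous d) {x : L} (hx : x ≠ 0) :
    IsSingularAt F L (Projectivization.mk k x hx) ↔ IsSingularVector F L x := by
  obtain ⟨c, hc, hrep⟩ := exists_mk_rep_eq_smul hx
  rw [← isSingularVector_smul_iff hF hc, ← hrep]
  rfl

theorem isNodeAt_mk_iff (hF : F.IsHomogeneous d) {x : L} (hx : x ≠ 0) :
    IsNodeAt F L (Projectivization.mk k x hx) ↔
      IsSingularVector F L x ∧ IsNondegenerateVector F L x := by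
  obtain ⟨c, hc, hrep⟩ := exists_mk_rep_eq_smul hx
  rw [← isSingularVector_smul_iff hF hc, ← isNondegenerateVector_smul_iff hF hc, ← hrep]
  rfl

theorem mk_eq_mk_iff_mem_span {x y : L} (hx : x ≠ 0) (hy : y ≠ 0) :
    Projectivization.mk k x hx = Projectivization.mk k y hy ↔
      (x : Fin n → k) ∈ Submodule.span k {(y : Fin n → k)} := by
  simp [Projectivization.mk_eq_mk_iff', Submodule.mem_span_singleton, Subtype.ext_iff]

theorem existsUnique_node_iff (hF : F.IsHomogeneous d) :
    (∃ p : ℙ k L, IsNodeAt F L p ∧ ∀ q : ℙ k L, IsSingularAt F L q → q = p) ↔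
      ∃ y ∈ L, y ≠ 0 ∧ (IsSingularVector F L y ∧ IsNondegenerateVector F L y) ∧
        ∀ z ∈ L, IsSingularVector F L z → z ∈ Submodule.span k {y} := by
  constructor
  · rintro ⟨p, hp, hunique⟩
    induction p using Projectivization.ind with | h y hy => ?_
    refine ⟨y, y.2, by simpa using hy, (isNodeAt_mk_iff hF hy).1 hp, fun z hzL hz => ?_⟩
    by_cases hz0 : (⟨z, hzL⟩ : L) = 0
    · simp [show z = 0 from congrArg Subtype.val hz0]
    · exact (mk_eq_mk_iff_mem_span hz0 hy).1 (hunique _ ((isSingularAt_mk_iff hF hz0).2 hz))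
  · rintro ⟨y, hyL, hy0, hnode, hunique⟩
    have hy : (⟨y, hyL⟩ : L) ≠ 0 := fun h => hy0 (congrArg Subtype.val h)
    refine ⟨Projectivization.mk k _ hy, (isNodeAt_mk_iff hF hy).2 hnode, fun q hq => ?_⟩
    induction q using Projectivization.ind with | h z hz => ?_
    exact (mk_eq_mk_iff_mem_span hz hy).2 (hunique z z.2 ((isSingularAt_mk_iff hF hz).1 hq))

end Homogeneous

end ProjHypersurface

namespace SegreCubic

section SectionSpace

variable {ι k : Type*} [Field k] {a v w x : ι → k}

/-- The vectors with coordinates `l + m * a i`. Under the standard bilinear form this is the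
orthogonal space of `sectionSpace a`. -/
def affineValues (a : ι → k) : Submodule k (ι → k) := Submodule.span k {1, a}

theorem mem_affineValues : w ∈ affineValues a ↔ ∃ l m : k, ∀ i, w i = l + m * a i := by
  simp [affineValues, Submodule.mem_span_pair, funext_iff, eq_comm]

variable [Fintype ι]

/-- The vectors `v` with `∑ i, v i = 0` and `∑ i, a i * v i = 0`: its projectivization is the
hyperplane with coordinates `a` of the projective space of vectors with coordinate sum zero. -/
def sectionSpace (a : ι → k) : Submodule k (ι → k) :=
  LinearMap.ker (dotProductBilin k k 1) ⊓ LinearMap.ker (dotProductBilin k k a)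

theorem mem_sectionSpace : v ∈ sectionSpace a ↔ ∑ i, v i = 0 ∧ a ⬝ᵥ v = 0 := by
  simp [sectionSpace, one_dotProduct]

theorem mem_affineValues_iff_forall_dotProduct_eq_zero :
    w ∈ affineValues a ↔ ∀ v ∈ sectionSpace a, w ⬝ᵥ v = 0 := by
  classical
  constructor
  · intro hw v hv
    obtain ⟨l, m, rfl⟩ := Submodule.mem_span_pair.1 hw
    simp [add_dotProduct, one_dotProduct, (mem_sectionSpace.1 hv).1, (mem_sectionSpace.1 hv).2]
  · intro hw
    have hspan : dotProductBilin k k w ∈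
        Submodule.span k (Set.range ![dotProductBilin k k 1, dotProductBilin k k a]) :=
      mem_span_of_iInf_ker_le_ker fun v hv => hw v (by
        simpa [mem_sectionSpace, Fin.forall_fin_two, one_dotProduct] using hv)
    simp only [Matrix.range_cons, Matrix.range_empty, Set.union_empty, Set.singleton_union,
      Submodule.mem_span_pair] at hspan
    obtain ⟨l, m, hlm⟩ := hspan
    refine Submodule.mem_span_pair.2 ⟨l, m, funext fun i => ?_⟩
    simpa using LinearMap.congr_fun hlm (Pi.single i 1)

theorem sum_pow_three_eq_zero_of_sq_mem (hx : x ∈ sectionSpace a) (hsq : x ^ 2 ∈ affineValues a) :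
    ∑ i, x i ^ 3 = 0 := by
  simpa [dotProduct, ← pow_succ] using
    mem_affineValues_iff_forall_dotProduct_eq_zero.1 hsq x hx

theorem eq_zero_of_mem_span_one [CharZero k] (ha : ∑ i, a i = 0)
    (h : a ∈ Submodule.span k {(1 : ι → k)}) : a = 0 := by
  obtain ⟨c, rfl⟩ := Submodule.mem_span_singleton.1 h
  cases isEmpty_or_nonempty ι
  · exact Subsingleton.elim _ _
  · have hc : c = 0 := by simpa using ha
    rw [hc, zero_smul]

end SectionSpace

section UniqueNodalVector

variable {ι k : Type*} [Fintype ι] [Field k] {a n v y : ι → k} {c : k}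

/-- `y` spans the unique point of the section of the cubic `∑ i, x i ^ 3 = 0` by the hyperplane with
coordinates `a` that is singular, and this point is a node of the section. Here `y ^ 2` and `y * v`
are coordinatewise products: up to scalars, they are the coefficient vectors of the differential
of the cubic form at `y` and of its Hessian at `y` applied to `v`. -/
structure IsUniqueNodalVector (a y : ι → k) : Prop where
  ne_zero : y ≠ 0
  mem_sectionSpace : y ∈ sectionSpace a
  sq_mem : y ^ 2 ∈ affineValues a
  mem_span_of_mul_mem : ∀ v ∈ sectionSpace a, y * v ∈ affineValues a → v ∈ Submodule.span k {y}
  mem_span_of_sq_mem : ∀ z ∈ sectionSpace a, z ^ 2 ∈ affineValues a → z ∈ Submodule.span k {y}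

theorem IsUniqueNodalVector.of_smul (hc : c ≠ 0) (h : IsUniqueNodalVector a (c • y)) :
    IsUniqueNodalVector a y where
  ne_zero := right_ne_zero_of_smul h.ne_zero
  mem_sectionSpace := (Submodule.smul_mem_iff _ hc).1 h.mem_sectionSpace
  sq_mem := (Submodule.smul_mem_iff _ (pow_ne_zero 2 hc)).1 (smul_pow c y 2 ▸ h.sq_mem)
  mem_span_of_mul_mem v hv hyv := Submodule.span_singleton_smul_eq hc.isUnit y ▸
    h.mem_span_of_mul_mem v hv (smul_mul_assoc c y v ▸ Submodule.smul_mem _ c hyv)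
  mem_span_of_sq_mem z hz hz2 := Submodule.span_singleton_smul_eq hc.isUnit y ▸
    h.mem_span_of_sq_mem z hz hz2

theorem mem_span_of_mul_mem_affineValues_of_sq_eq_one (hn : n ^ 2 = 1) (han : a ⬝ᵥ n = 0)
    (hsq : a ⬝ᵥ (a * n) ≠ 0) (hav : a ⬝ᵥ v = 0) (hnv : n * v ∈ affineValues a) :
    v ∈ Submodule.span k {n} := by
  obtain ⟨l, m, hlm⟩ := Submodule.mem_span_pair.1 hnv
  have hv : v = l • n + m • (a * n) := by
    rw [← one_mul v, ← hn, sq, mul_assoc, ← hlm]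
    ext i
    simp only [Pi.add_apply, Pi.mul_apply, Pi.smul_apply, Pi.one_apply, smul_eq_mul]
    ring
  have hm : m = 0 := by
    simpa [hv, han, hsq] using hav
  exact Submodule.mem_span_singleton.2 ⟨l, by simp [hv, hm]⟩

theorem dotProduct_mul_ne_zero_of_sq_eq_one [CharZero k] (ha : ∑ i, a i = 0) (ha0 : a ≠ 0)
    (hn : n ^ 2 = 1) (han : a ⬝ᵥ n = 0)
    (hnode : ∀ v ∈ sectionSpace a, n * v ∈ affineValues a → v ∈ Submodule.span k {n}) :
    a ⬝ᵥ (a * n) ≠ 0 := by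
  intro hsq
  have hmul : n * (a * n) = a := by rw [mul_left_comm, ← sq, hn, mul_one]
  obtain ⟨c, hc⟩ := Submodule.mem_span_singleton.1 <|
    hnode (a * n) (mem_sectionSpace.2 ⟨han, hsq⟩) <| by
      rw [hmul]
      exact Submodule.subset_span (by simp)
  refine ha0 (eq_zero_of_mem_span_one ha (Submodule.mem_span_singleton.2 ⟨c, ?_⟩))
  rw [← hmul, ← hc, mul_smul_comm, ← sq, hn]

end UniqueNodalVector

section SymmetricFunctions

open Polynomial

open Finset.HasAntidiagonal (antidiagonal)

variable {ι k : Type*} [Fintype ι] [Field k] {x u : ι → k}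

/-- The value at `x` of the `n`-th elementary symmetric polynomial. -/
noncomputable def esymmAt (x : ι → k) (n : ℕ) : k := MvPolynomial.eval x (MvPolynomial.esymm ι k n)

theorem esymmAt_eq_sum_prod_erase [DecidableEq ι] (x : ι → k) {n : ℕ}
    (hn : Fintype.card ι = n + 1) :
    esymmAt x n = ∑ i, ∏ j ∈ Finset.univ.erase i, x j := by
  simp only [esymmAt, MvPolynomial.esymm, map_sum, map_prod, MvPolynomial.eval_X]
  refine (Finset.sum_bij (fun i _ => Finset.univ.erase i) ?_ ?_ ?_ fun _ _ => rfl).symm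
  · intro i _
    simp [Finset.mem_powersetCard, Finset.card_erase_of_mem, hn]
  · intro i _ j _ hij
    simpa using congrArg (i ∈ ·) hij
  · intro t ht
    obtain ⟨i, hi⟩ := Finset.card_eq_one.1 (show tᶜ.card = 1 by
      rw [Finset.card_compl, hn, (Finset.mem_powersetCard.1 ht).2]; omega)
    exact ⟨i, Finset.mem_univ i, by rw [← compl_compl t, hi, Finset.compl_singleton]⟩

theorem eq_of_esymmAt_ne_zero_of_eq_zero {n : ℕ} (hn : Fintype.card ι = n + 1)
    (hx : esymmAt x n ≠ 0) {i : ι} (hi : x i = 0) {j : ι} (hj : x j = 0) : i = j := by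
  classical
  by_contra hij
  refine hx ((esymmAt_eq_sum_prod_erase x hn).trans (Finset.sum_eq_zero fun m _ => ?_))
  by_cases hm : m = i
  · exact Finset.prod_eq_zero (i := j) (by simp [hm, Ne.symm hij]) hj
  · exact Finset.prod_eq_zero (i := i) (by simp [Ne.symm hm]) hi

theorem eq_zero_of_mul_eq_const {n : ℕ} (hn : Fintype.card ι = n + 1) (hx : esymmAt x n ≠ 0)
    (hu : ∑ i, u i = 0) {c : k} (h : ∀ i, x i * u i = c) : u = 0 := by
  classical
  have hc : c = 0 := by
    refine (mul_eq_zero.1 ?_).resolve_right hx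
    calc c * esymmAt x n = ∑ i, (∏ j, x j) * u i := by
          rw [esymmAt_eq_sum_prod_erase x hn, Finset.mul_sum]
          refine Finset.sum_congr rfl fun i _ => ?_
          rw [← h i, ← Finset.mul_prod_erase _ _ (Finset.mem_univ i)]
          ring
      _ = 0 := by rw [← Finset.mul_sum, hu, mul_zero]
  have hxu (i : ι) : x i = 0 ∨ u i = 0 := mul_eq_zero.1 ((h i).trans hc)
  ext i
  refine (hxu i).elim (fun hi => ?_) id
  rw [Pi.zero_apply, ← hu, Finset.sum_eq_single i (fun j _ hji => (hxu j).resolve_left fun hj =>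
    hji (eq_of_esymmAt_ne_zero_of_eq_zero hn hx hj hi)) (by simp)]

theorem mem_span_of_mul_mem_affineValues {a v y : ι → k} {n : ℕ} (hn : Fintype.card ι = n + 1)
    (hy : ∑ i, y i = 0) (hyn : esymmAt y n ≠ 0) (hsq : y ^ 2 ∈ affineValues a)
    (hsq1 : y ^ 2 ∉ Submodule.span k {1}) (hv : ∑ i, v i = 0) (hyv : y * v ∈ affineValues a) :
    v ∈ Submodule.span k {y} := by
  obtain ⟨l, m, hlm⟩ := mem_affineValues.1 hsq
  obtain ⟨l', m', hlm'⟩ := mem_affineValues.1 hyv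
  have hm : m ≠ 0 := by
    rintro rfl
    exact hsq1 (Submodule.mem_span_singleton.2 ⟨l, funext fun i => by simp [hlm]⟩)
  refine Submodule.mem_span_singleton.2 ⟨m' / m, (sub_eq_zero.1 ?_).symm⟩
  refine eq_zero_of_mul_eq_const hn hyn (c := l' - m' / m * l) ?_ fun i => ?_
  · simp [Finset.sum_sub_distrib, ← Finset.mul_sum, hv, hy]
  · have hsqi := hlm i
    have hmuli := hlm' i
    simp only [Pi.pow_apply, Pi.mul_apply, Pi.sub_apply, Pi.smul_apply, smul_eq_mul]
      at hsqi hmuli ⊢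
    linear_combination hmuli - m' / m * hsqi - m' * a i * (div_mul_cancel₀ 1 hm)

theorem esymmAt_zero (x : ι → k) : esymmAt x 0 = 1 := by
  simp [esymmAt]

theorem esymmAt_one (x : ι → k) : esymmAt x 1 = ∑ i, x i := by
  simp [esymmAt, MvPolynomial.esymm_one]

theorem sum_pow_eq_esymmAt (x : ι → k) {n : ℕ} (hn : 0 < n) :
    ∑ i, x i ^ n = (-1) ^ (n + 1) * n * esymmAt x n -
      ∑ p ∈ antidiagonal n with p.1 ∈ Set.Ioo 0 n,
        (-1) ^ p.1 * esymmAt x p.1 * ∑ i, x i ^ p.2 := by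
  simpa [MvPolynomial.psum, esymmAt] using
    congrArg (MvPolynomial.eval x) (MvPolynomial.psum_eq_mul_esymm_sub_sum ι k n hn)

theorem sum_sq_eq_esymmAt (hx : ∑ i, x i = 0) : ∑ i, x i ^ 2 = -2 * esymmAt x 2 := by
  rw [sum_pow_eq_esymmAt x two_pos, show (antidiagonal 2).filter (·.1 ∈ Set.Ioo 0 2) =
    {(1, 1)} by decide]
  simp [hx, pow_succ]

theorem sum_pow_three_eq_esymmAt (hx : ∑ i, x i = 0) : ∑ i, x i ^ 3 = 3 * esymmAt x 3 := by
  rw [sum_pow_eq_esymmAt x three_pos, show (antidiagonal 3).filter (·.1 ∈ Set.Ioo 0 3) =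
    {(1, 2), (2, 1)} by decide]
  simp [hx, esymmAt_one, pow_succ]

theorem sum_pow_four_eq_esymmAt (hx : ∑ i, x i = 0) :
    ∑ i, x i ^ 4 = 2 * esymmAt x 2 ^ 2 - 4 * esymmAt x 4 := by
  rw [sum_pow_eq_esymmAt x four_pos, show (antidiagonal 4).filter (·.1 ∈ Set.Ioo 0 4) =
    {(1, 3), (2, 2), (3, 1)} by decide]
  rw [Finset.sum_insert (by decide), Finset.sum_insert (by decide), Finset.sum_singleton]
  simp only [esymmAt_one, hx, pow_one, sum_sq_eq_esymmAt]
  push_cast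
  ring

theorem sum_pow_six_eq_esymmAt (hx : ∑ i, x i = 0) :
    ∑ i, x i ^ 6 = -2 * esymmAt x 2 ^ 3 + 6 * esymmAt x 2 * esymmAt x 4 + 3 * esymmAt x 3 ^ 2 -
      6 * esymmAt x 6 := by
  rw [sum_pow_eq_esymmAt x (by decide : 0 < 6),
    show (antidiagonal 6).filter (·.1 ∈ Set.Ioo 0 6) = {(1, 5), (2, 4), (3, 3), (4, 2), (5, 1)}
      by decide]
  rw [Finset.sum_insert (by decide), Finset.sum_insert (by decide), Finset.sum_insert (by decide),
    Finset.sum_insert (by decide), Finset.sum_singleton]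
  simp only [esymmAt_one, hx, pow_one, sum_sq_eq_esymmAt, sum_pow_three_eq_esymmAt,
    sum_pow_four_eq_esymmAt]
  push_cast
  ring

theorem prod_X_sub_C_eq_sum_esymmAt (x : ι → k) :
    ∏ i, (X - C (x i)) = ∑ j ∈ Finset.range (Fintype.card ι + 1),
      (-1) ^ j * (C (esymmAt x j) * X ^ (Fintype.card ι - j)) := by
  have hesymm (j : ℕ) : (Finset.univ.val.map x).esymm j = esymmAt x j :=
    (MvPolynomial.aeval_esymm_eq_multiset_esymm ι k j x).symm
  have hvieta := Multiset.prod_X_sub_X_eq_sum_esymm (Finset.univ.val.map x)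
  simp only [Multiset.map_map, Multiset.card_map, hesymm] at hvieta
  exact hvieta

theorem eval_prod_X_sub_C_self (x : ι → k) (i : ι) : (∏ j, (X - C (x j))).eval (x i) = 0 := by
  rw [eval_prod]
  exact Finset.prod_eq_zero (Finset.mem_univ i) (by simp)

theorem exists_perm_of_map_univ_eq {α : Type*} {f g : ι → α}
    (h : Finset.univ.val.map f = Finset.univ.val.map g) : ∃ σ : Equiv.Perm ι, f = g ∘ σ := by
  classical
  have hfiber (c : α) : Nonempty ({i // f i = c} ≃ {i // g i = c}) := by
    refine ⟨Fintype.equivOfCardEq ?_⟩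
    simpa [Fintype.card_subtype, Multiset.count_map, Finset.card, eq_comm] using
      congrArg (Multiset.count c) h
  exact ⟨Equiv.ofFiberEquiv fun c => (hfiber c).some,
    funext fun i => (Equiv.ofFiberEquiv_map _ i).symm⟩

end SymmetricFunctions

section Sextic

open Polynomial

variable {k : Type*} [Field k] {a x z : Fin 6 → k}

theorem prod_X_sub_C_eq_of_sum_eq_zero (hx : ∑ i, x i = 0) :
    ∏ i, (X - C (x i)) = X ^ 6 + C (esymmAt x 2) * X ^ 4 - C (esymmAt x 3) * X ^ 3 +
      C (esymmAt x 4) * X ^ 2 - C (esymmAt x 5) * X + C (esymmAt x 6) := by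
  rw [prod_X_sub_C_eq_sum_esymmAt]
  simp only [Fintype.card_fin, Finset.sum_range_succ, Finset.sum_range_zero, esymmAt_zero,
    esymmAt_one, hx, map_zero, map_one, Nat.reduceAdd, Nat.reduceSub]
  ring

/-- The quartic form in the coordinates of a hyperplane which defines the Castelnuovo–Richmond
quartic. -/
def castelnuovoRichmondForm (a : Fin 6 → k) : k := (∑ i, a i ^ 2) ^ 2 - 4 * ∑ i, a i ^ 4

/-- The polynomial part of the square root of `∏ i, (X - a i)`, for `∑ i, a i = 0`: the unique monic
cubic whose square agrees with this sextic in degrees at least three. -/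
noncomputable def sqrtCubic (a : Fin 6 → k) : k[X] :=
  X ^ 3 - C ((∑ i, a i ^ 2) / 4) * X - C ((∑ i, a i ^ 3) / 6)

/-- The values of `sqrtCubic a` at the coordinates of `a`: up to scalars, the only candidate for a
singular point of the hyperplane section which is not a node of the Segre cubic. -/
noncomputable def sqrtVector (a : Fin 6 → k) (i : Fin 6) : k := (sqrtCubic a).eval (a i)

theorem sqrtVector_apply (a : Fin 6 → k) (i : Fin 6) :
    sqrtVector a i = a i ^ 3 - (∑ j, a j ^ 2) / 4 * a i - (∑ j, a j ^ 3) / 6 := by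
  simp [sqrtVector, sqrtCubic]

theorem sqrtVector_sq_eq_of_prod_X_sub_C_eq {α β : k}
    (hprod : ∏ i, (X - C (a i)) = sqrtCubic a ^ 2 - (C α * X + C β)) (i : Fin 6) :
    sqrtVector a i ^ 2 = α * a i + β := by
  have heval := congrArg (eval (a i)) hprod
  rw [eval_prod_X_sub_C_self] at heval
  simp only [eval_sub, eval_pow, eval_add, eval_mul, eval_C, eval_X] at heval
  rw [sqrtVector]
  linear_combination -heval

variable [CharZero k]

theorem sum_sqrtVector (ha : ∑ i, a i = 0) : ∑ i, sqrtVector a i = 0 := by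
  simp only [sqrtVector_apply, Finset.sum_sub_distrib, ← Finset.mul_sum, ha, Finset.sum_const,
    Finset.card_univ, Fintype.card_fin, nsmul_eq_mul]
  push_cast
  ring

theorem dotProduct_sqrtVector (ha : ∑ i, a i = 0) :
    a ⬝ᵥ sqrtVector a = -castelnuovoRichmondForm a / 4 := by
  have hterm (i : Fin 6) : a i * sqrtVector a i =
      a i ^ 4 - (∑ j, a j ^ 2) / 4 * a i ^ 2 - (∑ j, a j ^ 3) / 6 * a i := by
    rw [sqrtVector_apply]
    ring
  simp only [dotProduct, hterm, Finset.sum_sub_distrib, ← Finset.mul_sum, ha,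
    castelnuovoRichmondForm]
  ring

theorem sqrtVector_mem_sectionSpace_iff (ha : ∑ i, a i = 0) :
    sqrtVector a ∈ sectionSpace a ↔ castelnuovoRichmondForm a = 0 := by
  simp [mem_sectionSpace, sum_sqrtVector ha, dotProduct_sqrtVector ha]

theorem exists_prod_X_sub_C_eq_sqrtCubic_sq_sub (ha : ∑ i, a i = 0)
    (hform : castelnuovoRichmondForm a = 0) :
    ∃ α β : k, ∏ i, (X - C (a i)) = sqrtCubic a ^ 2 - (C α * X + C β) := by
  rw [castelnuovoRichmondForm, sum_sq_eq_esymmAt ha, sum_pow_four_eq_esymmAt ha] at hform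
  have hsqrt : sqrtCubic a = X ^ 3 + C (esymmAt a 2 / 2) * X - C (esymmAt a 3 / 2) := by
    rw [sqrtCubic, sum_sq_eq_esymmAt ha, sum_pow_three_eq_esymmAt ha,
      show -2 * esymmAt a 2 / 4 = -(esymmAt a 2 / 2) by ring,
      show 3 * esymmAt a 3 / 6 = esymmAt a 3 / 2 by ring, C_neg]
    ring
  refine ⟨esymmAt a 5 - esymmAt a 2 * esymmAt a 3 / 2, esymmAt a 3 ^ 2 / 4 - esymmAt a 6,
    Polynomial.funext fun t => ?_⟩
  rw [prod_X_sub_C_eq_of_sum_eq_zero ha, hsqrt]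
  simp only [eval_add, eval_sub, eval_mul, eval_pow, eval_X, eval_C]
  linear_combination t ^ 2 * hform / 16

theorem pow_three_smul_sqrtVector (ha : ∑ i, a i = 0) (hz : ∑ i, z i = 0)
    (hz3 : ∑ i, z i ^ 3 = 0) {l m : k} (hsq : ∀ i, z i ^ 2 = l + m * a i) :
    m ^ 3 • sqrtVector a = esymmAt z 5 • z := by
  have hma (i : Fin 6) : m * a i = z i ^ 2 - l := by rw [hsq]; ring
  have hpow (n : ℕ) : m ^ n * ∑ i, a i ^ n = ∑ i, (z i ^ 2 - l) ^ n := by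
    simp only [Finset.mul_sum, ← mul_pow, hma]
  have he2 : esymmAt z 2 = -3 * l := by
    have hsum : ∑ i, (l + m * a i) = -2 * esymmAt z 2 := by
      simp only [← hsq, sum_sq_eq_esymmAt hz]
    simp only [Fin.sum_univ_six] at hsum ha
    linear_combination (hsum - m * ha) / 2
  have he3 : esymmAt z 3 = 0 := by
    simpa [hz3] using (sum_pow_three_eq_esymmAt hz).symm
  have ha2 : m ^ 2 * ∑ i, a i ^ 2 = ∑ i, z i ^ 4 - 2 * l * ∑ i, z i ^ 2 + 6 * l ^ 2 := by
    rw [hpow]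
    simp only [Fin.sum_univ_six]
    ring
  have ha3 : m ^ 3 * ∑ i, a i ^ 3 =
      ∑ i, z i ^ 6 - 3 * l * ∑ i, z i ^ 4 + 3 * l ^ 2 * ∑ i, z i ^ 2 - 6 * l ^ 3 := by
    rw [hpow]
    simp only [Fin.sum_univ_six]
    ring
  rw [sum_pow_four_eq_esymmAt hz, sum_sq_eq_esymmAt hz] at ha2
  rw [sum_pow_six_eq_esymmAt hz, sum_pow_four_eq_esymmAt hz, sum_sq_eq_esymmAt hz] at ha3
  ext i
  have hroot : z i ^ 6 + esymmAt z 2 * z i ^ 4 - esymmAt z 3 * z i ^ 3 + esymmAt z 4 * z i ^ 2 -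
      esymmAt z 5 * z i + esymmAt z 6 = 0 := by
    simpa [prod_X_sub_C_eq_of_sum_eq_zero hz] using eval_prod_X_sub_C_self z i
  rw [he2] at ha2
  rw [he2, he3] at hroot ha3
  simp only [Pi.smul_apply, smul_eq_mul, sqrtVector_apply]
  linear_combination hroot +
    (m ^ 2 * a i ^ 2 + m * a i * (z i ^ 2 - l) + (z i ^ 2 - l) ^ 2) * hma i -
    m * a i * ha2 / 4 - ha3 / 6 + (esymmAt z 4 - 3 * l ^ 2) * hma i

theorem exists_sqrtVector_eq_smul (ha : ∑ i, a i = 0) (hz : z ∈ sectionSpace a)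
    (hsq : z ^ 2 ∈ affineValues a) (hsq1 : z ^ 2 ∉ Submodule.span k {1}) :
    ∃ c : k, sqrtVector a = (c * esymmAt z 5) • z := by
  obtain ⟨l, m, hlm⟩ := mem_affineValues.1 hsq
  have hm : m ≠ 0 := by
    rintro rfl
    exact hsq1 (Submodule.mem_span_singleton.2 ⟨l, funext fun i => by simp [hlm]⟩)
  refine ⟨(m ^ 3)⁻¹, ?_⟩
  rw [mul_smul, ← pow_three_smul_sqrtVector ha (mem_sectionSpace.1 hz).1
    (sum_pow_three_eq_zero_of_sq_mem hz hsq) hlm, inv_smul_smul₀ (pow_ne_zero 3 hm)]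

theorem castelnuovoRichmondForm_eq_zero_of_sq_mem (ha : ∑ i, a i = 0) (hz : z ∈ sectionSpace a)
    (hsq : z ^ 2 ∈ affineValues a) (hsq1 : z ^ 2 ∉ Submodule.span k {1}) :
    castelnuovoRichmondForm a = 0 := by
  obtain ⟨c, hc⟩ := exists_sqrtVector_eq_smul ha hz hsq hsq1
  rw [← sqrtVector_mem_sectionSpace_iff ha, hc]
  exact Submodule.smul_mem _ _ hz

end Sextic

section NodeVector

open Polynomial

variable {k : Type*} [Field k] {a y : Fin 6 → k} {σ : Equiv.Perm (Fin 6)}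

theorem nodeVector_sq (σ : Equiv.Perm (Fin 6)) : (nodeVector k σ : Fin 6 → k) ^ 2 = 1 := by
  have hvalues (j : Fin 6) : (![1, 1, 1, -1, -1, -1] : Fin 6 → k) j ^ 2 = 1 := by
    fin_cases j <;> simp
  exact funext fun i => hvalues (σ i)

theorem nodeVector_mem_sectionSpace_iff :
    (nodeVector k σ : Fin 6 → k) ∈ sectionSpace a ↔ a ⬝ᵥ nodeVector k σ = 0 :=
  mem_sectionSpace.trans (and_iff_right (mem_Wdual.1 (nodeVector k σ).2))

theorem nodeVector_sq_mem_affineValues (a : Fin 6 → k) (σ : Equiv.Perm (Fin 6)) :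
    (nodeVector k σ : Fin 6 → k) ^ 2 ∈ affineValues a :=
  nodeVector_sq (k := k) σ ▸ Submodule.subset_span (by simp)

theorem exists_eq_replicate_add_replicate {α : Type*} {r t : α} {s : Multiset α}
    (hs : ∀ x ∈ s, x = r ∨ x = t) :
    ∃ m n : ℕ, s = Multiset.replicate m r + Multiset.replicate n t := by
  induction s using Multiset.induction with
  | empty => exact ⟨0, 0, rfl⟩
  | cons x s ih =>
    obtain ⟨m, n, rfl⟩ := ih fun z hz => hs z (Multiset.mem_cons_of_mem hz)
    rcases hs x (Multiset.mem_cons_self _ _) with rfl | rfl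
    · exact ⟨m + 1, n, by rw [Multiset.replicate_succ, Multiset.cons_add]⟩
    · exact ⟨m, n + 1, by rw [Multiset.replicate_succ, Multiset.add_cons]⟩

theorem exists_dotProduct_nodeVector_eq_zero_of_prod_eq_sq {q : k[X]}
    (h : ∏ i, (X - C (a i)) = q ^ 2) : ∃ σ, a ⬝ᵥ nodeVector k σ = 0 := by
  have hroots : Finset.univ.val.map a = 2 • q.roots := by
    rw [← roots_pow, ← h, ← roots_multiset_prod_X_sub_C (Finset.univ.val.map a), Multiset.map_map]
    rfl
  have hcard : q.roots.card = 3 := by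
    have := congrArg Multiset.card hroots
    simp only [Multiset.card_map, Finset.card_val, Finset.card_univ, Fintype.card_fin,
      Multiset.card_nsmul] at this
    omega
  obtain ⟨r, s, t, hrst⟩ := Multiset.card_eq_three.1 hcard
  obtain ⟨σ, rfl⟩ := exists_perm_of_map_univ_eq (f := a) (g := ![r, s, t, r, s, t]) <| by
    rw [hroots, hrst, two_nsmul]
    rfl
  refine ⟨σ, (comp_equiv_dotProduct_comp_equiv _ ![1, 1, 1, -1, -1, -1] σ).trans ?_⟩
  simp only [dotProduct, Fin.sum_univ_six, Matrix.cons_val]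
  ring

theorem castelnuovoRichmondForm_comp_perm (a : Fin 6 → k) (σ : Equiv.Perm (Fin 6)) :
    castelnuovoRichmondForm (a ∘ σ) = castelnuovoRichmondForm a := by
  simp only [castelnuovoRichmondForm, Function.comp_apply, Equiv.sum_comp σ (a · ^ 2),
    Equiv.sum_comp σ (a · ^ 4)]

variable [CharZero k]

theorem exists_nodeVector_of_sq_mem_span_one (hy0 : y ≠ 0) (hy : ∑ i, y i = 0)
    (hsq : y ^ 2 ∈ Submodule.span k {1}) :
    ∃ (σ : Equiv.Perm (Fin 6)) (r : k), r ≠ 0 ∧ y = r • (nodeVector k σ : Fin 6 → k) := by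
  obtain ⟨c, hc⟩ := Submodule.mem_span_singleton.1 hsq
  obtain ⟨j, hj⟩ := Function.ne_iff.1 hy0
  have hc_apply (i : Fin 6) : y i ^ 2 = c := by simpa using (congrFun hc i).symm
  obtain ⟨m, n, hmn⟩ := exists_eq_replicate_add_replicate (r := y j) (t := -y j)
    (s := Finset.univ.val.map y) <| by
      simp [← sq_eq_sq_iff_eq_or_eq_neg, hc_apply]
  have hcard : 6 = m + n := by simpa using congrArg Multiset.card hmn
  have hsum : (m : k) = n := by
    have hsum_zero : (Finset.univ.val.map y).sum = 0 := hy
    exact mul_right_cancel₀ hj (by simpa [hmn, ← sub_eq_add_neg, sub_eq_zero] using hsum_zero)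
  obtain ⟨rfl, rfl⟩ : m = 3 ∧ n = 3 := by
    have : m = n := by exact_mod_cast hsum
    omega
  obtain ⟨σ, hσ⟩ := exists_perm_of_map_univ_eq (f := y) (g := y j • ![1, 1, 1, -1, -1, -1]) <| by
    rw [hmn, ← Multiset.coe_replicate, ← Multiset.coe_replicate, Multiset.coe_add]
    simp [Fin.univ_val_map, List.ofFn_succ, List.replicate]
  exact ⟨σ, y j, hj, hσ⟩

theorem castelnuovoRichmondForm_eq_neg_sq (ha : ∑ i, a i = 0) (hσ : a ⬝ᵥ nodeVector k σ = 0) :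
    castelnuovoRichmondForm a = -(a ⬝ᵥ (a * nodeVector k σ)) ^ 2 := by
  obtain ⟨b, rfl⟩ : ∃ b, a = b ∘ σ := ⟨a ∘ σ.symm, by ext; simp⟩
  have hb : ∑ i, b i = 0 := (Equiv.sum_comp σ b).symm.trans ha
  have hbn : b ⬝ᵥ ![1, 1, 1, -1, -1, -1] = 0 := (comp_equiv_dotProduct_comp_equiv ..).symm.trans hσ
  have hreindex : (b ∘ σ) ⬝ᵥ (b ∘ σ * nodeVector k σ) = b ⬝ᵥ (b * ![1, 1, 1, -1, -1, -1]) :=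
    comp_equiv_dotProduct_comp_equiv b (fun i => b i * (![1, 1, 1, -1, -1, -1] : Fin 6 → k) i) σ
  rw [hreindex, castelnuovoRichmondForm_comp_perm]
  simp only [dotProduct, Fin.sum_univ_six, Pi.mul_apply, castelnuovoRichmondForm,
    Matrix.cons_val] at hb hbn ⊢
  have h2 : b 2 = -b 0 - b 1 := by linear_combination (hb + hbn) / 2
  have h5 : b 5 = -b 3 - b 4 := by linear_combination (hb - hbn) / 2
  rw [h2, h5]
  ring

theorem sq_notMem_span_one_of_dotProduct_nodeVector_ne_zero
    (hnodes : ∀ σ, a ⬝ᵥ nodeVector k σ ≠ 0) (hy0 : y ≠ 0) (hy : y ∈ sectionSpace a) :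
    y ^ 2 ∉ Submodule.span k {1} := by
  intro hsq
  obtain ⟨σ, r, hr, rfl⟩ := exists_nodeVector_of_sq_mem_span_one hy0 (mem_sectionSpace.1 hy).1 hsq
  exact hnodes σ (nodeVector_mem_sectionSpace_iff.1 ((Submodule.smul_mem_iff _ hr).1 hy))

theorem isUniqueNodalVector_nodeVector_iff (ha : ∑ i, a i = 0) (ha0 : a ≠ 0) :
    IsUniqueNodalVector a (nodeVector k σ) ↔
      a ⬝ᵥ nodeVector k σ = 0 ∧ castelnuovoRichmondForm a ≠ 0 ∧
        ∀ τ, a ⬝ᵥ nodeVector k τ = 0 →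
          (nodeVector k τ : Fin 6 → k) ∈ Submodule.span k {(nodeVector k σ : Fin 6 → k)} := by
  constructor
  · intro h
    have hσ := nodeVector_mem_sectionSpace_iff.1 h.mem_sectionSpace
    refine ⟨hσ, ?_, fun τ hτ => h.mem_span_of_sq_mem _ (nodeVector_mem_sectionSpace_iff.2 hτ)
      (nodeVector_sq_mem_affineValues a τ)⟩
    rw [castelnuovoRichmondForm_eq_neg_sq ha hσ]
    exact neg_ne_zero.2 <| pow_ne_zero 2 <|
      dotProduct_mul_ne_zero_of_sq_eq_one ha ha0 (nodeVector_sq σ) hσ h.mem_span_of_mul_mem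
  · rintro ⟨hσ, hform, hunique⟩
    have hsq : a ⬝ᵥ (a * nodeVector k σ) ≠ 0 := fun h =>
      hform (by simp [castelnuovoRichmondForm_eq_neg_sq ha hσ, h])
    refine ⟨Subtype.coe_ne_coe.2 (nodeVector_ne_zero σ), nodeVector_mem_sectionSpace_iff.2 hσ,
      nodeVector_sq_mem_affineValues a σ, fun v hv => mem_span_of_mul_mem_affineValues_of_sq_eq_one
        (nodeVector_sq σ) hσ hsq (mem_sectionSpace.1 hv).2, fun z hz hz2 => ?_⟩
    rcases eq_or_ne z 0 with rfl | hz0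
    · exact zero_mem _
    have hz1 : z ^ 2 ∈ Submodule.span k {1} := by
      by_contra hz1
      exact hform (castelnuovoRichmondForm_eq_zero_of_sq_mem ha hz hz2 hz1)
    obtain ⟨τ, r, hr, rfl⟩ :=
      exists_nodeVector_of_sq_mem_span_one hz0 (mem_sectionSpace.1 hz).1 hz1
    exact Submodule.smul_mem _ r <| hunique τ <|
      nodeVector_mem_sectionSpace_iff.1 ((Submodule.smul_mem_iff _ hr).1 hz)

theorem sqrtVector_sq_mem_affineValues (ha : ∑ i, a i = 0) (hform : castelnuovoRichmondForm a = 0) :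
    sqrtVector a ^ 2 ∈ affineValues a := by
  obtain ⟨α, β, hprod⟩ := exists_prod_X_sub_C_eq_sqrtCubic_sq_sub ha hform
  exact mem_affineValues.2 ⟨β, α, fun i =>
    (sqrtVector_sq_eq_of_prod_X_sub_C_eq hprod i).trans (add_comm _ _)⟩

theorem sqrtVector_ne_zero (ha : ∑ i, a i = 0) (ha0 : a ≠ 0)
    (hform : castelnuovoRichmondForm a = 0) (hnodes : ∀ σ, a ⬝ᵥ nodeVector k σ ≠ 0) :
    sqrtVector a ≠ 0 := by
  intro hzero
  obtain ⟨α, β, hprod⟩ := exists_prod_X_sub_C_eq_sqrtCubic_sq_sub ha hform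
  have hremainder (i : Fin 6) : α * a i + β = 0 := by
    simp [← sqrtVector_sq_eq_of_prod_X_sub_C_eq hprod i, hzero]
  have hα : α = 0 := by
    by_contra hα
    refine ha0 (eq_zero_of_mem_span_one ha (Submodule.mem_span_singleton.2 ⟨-β / α, ?_⟩))
    ext i
    simp only [Pi.smul_apply, Pi.one_apply, smul_eq_mul]
    field_simp
    linear_combination -hremainder i
  have hβ : β = 0 := by simpa [hα] using hremainder 0
  obtain ⟨σ, hσ⟩ := exists_dotProduct_nodeVector_eq_zero_of_prod_eq_sq (a := a)
    (q := sqrtCubic a) (by simp [hprod, hα, hβ])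
  exact hnodes σ hσ

theorem isUniqueNodalVector_sqrtVector (ha : ∑ i, a i = 0) (ha0 : a ≠ 0)
    (hform : castelnuovoRichmondForm a = 0) (hnodes : ∀ σ, a ⬝ᵥ nodeVector k σ ≠ 0) :
    IsUniqueNodalVector a (sqrtVector a) := by
  have hy := (sqrtVector_mem_sectionSpace_iff ha).2 hform
  have hsq := sqrtVector_sq_mem_affineValues ha hform
  have hy0 := sqrtVector_ne_zero ha ha0 hform hnodes
  have hsq1 := sq_notMem_span_one_of_dotProduct_nodeVector_ne_zero hnodes hy0 hy
  have he5 : esymmAt (sqrtVector a) 5 ≠ 0 := by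
    obtain ⟨c, hc⟩ := exists_sqrtVector_eq_smul ha hy hsq hsq1
    exact fun he5 => hy0 (by simpa [he5] using hc)
  refine ⟨hy0, hy, hsq, fun v hv => mem_span_of_mul_mem_affineValues (by simp)
    (sum_sqrtVector ha) he5 hsq hsq1 (mem_sectionSpace.1 hv).1, fun z hz hz2 => ?_⟩
  rcases eq_or_ne z 0 with rfl | hz0
  · exact zero_mem _
  obtain ⟨c, hc⟩ := exists_sqrtVector_eq_smul ha hz hz2
    (sq_notMem_span_one_of_dotProduct_nodeVector_ne_zero hnodes hz0 hz)
  have hc0 : c * esymmAt z 5 ≠ 0 := fun hc0 => hy0 (by simpa [hc0] using hc)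
  exact Submodule.mem_span_singleton.2 ⟨_, by rw [hc, inv_smul_smul₀ hc0]⟩

theorem exists_isUniqueNodalVector_iff (ha : ∑ i, a i = 0) (ha0 : a ≠ 0) :
    (∃ y, IsUniqueNodalVector a y) ↔
      (∃ σ, a ⬝ᵥ nodeVector k σ = 0 ∧ castelnuovoRichmondForm a ≠ 0 ∧
        ∀ τ, a ⬝ᵥ nodeVector k τ = 0 →
          (nodeVector k τ : Fin 6 → k) ∈ Submodule.span k {(nodeVector k σ : Fin 6 → k)}) ∨
      (castelnuovoRichmondForm a = 0 ∧ ∀ σ, a ⬝ᵥ nodeVector k σ ≠ 0) := by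
  simp only [← isUniqueNodalVector_nodeVector_iff ha ha0]
  constructor
  · rintro ⟨y, hy⟩
    by_cases hsq1 : y ^ 2 ∈ Submodule.span k {1}
    · obtain ⟨σ, r, hr, rfl⟩ := exists_nodeVector_of_sq_mem_span_one hy.ne_zero
        (mem_sectionSpace.1 hy.mem_sectionSpace).1 hsq1
      exact Or.inl ⟨σ, hy.of_smul hr⟩
    · refine Or.inr ⟨castelnuovoRichmondForm_eq_zero_of_sq_mem ha hy.mem_sectionSpace hy.sq_mem
        hsq1, fun σ hσ => hsq1 ?_⟩
      obtain ⟨c, hc⟩ := Submodule.mem_span_singleton.1 <| hy.mem_span_of_sq_mem _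
        (nodeVector_mem_sectionSpace_iff.2 hσ) (nodeVector_sq_mem_affineValues a σ)
      have hc2 : c ^ 2 • y ^ 2 = 1 := by rw [← _root_.smul_pow, hc, nodeVector_sq]
      have hc0 : c ^ 2 ≠ 0 := fun hc0 => by simp [hc0] at hc2
      exact (Submodule.smul_mem_iff _ hc0).1 <| by
        rw [hc2]
        exact Submodule.mem_span_singleton_self 1
  · rintro (⟨σ, hσ⟩ | ⟨hform, hnodes⟩)
    · exact ⟨_, hσ⟩
    · exact ⟨_, isUniqueNodalVector_sqrtVector ha ha0 hform hnodes⟩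

end NodeVector

section HyperplaneSection

open ProjHypersurface

variable {k : Type*} [Field k] {a x : Fin 6 → k} {L : Submodule k (Fin 6 → k)}

theorem pderiv_segreForm (i : Fin 6) :
    MvPolynomial.pderiv i (segreForm k) = MvPolynomial.C 3 * MvPolynomial.X i ^ 2 := by
  simp [segreForm, MvPolynomial.pderiv_X, Pi.single_apply, Derivation.leibniz_pow,
    map_ofNat MvPolynomial.C]

theorem eval_segreForm (x : Fin 6 → k) : MvPolynomial.eval x (segreForm k) = ∑ i, x i ^ 3 := by
  simp [segreForm]

theorem dirDeriv_segreForm (x v : Fin 6 → k) :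
    dirDeriv (segreForm k) x v = 3 * (x ^ 2 ⬝ᵥ v) := by
  simp only [dirDeriv, pderiv_segreForm, map_mul, map_pow, MvPolynomial.eval_C,
    MvPolynomial.eval_X, dotProduct, Finset.mul_sum, Pi.pow_apply]
  exact Finset.sum_congr rfl fun i _ => by ring

theorem hessian_segreForm (x v w : Fin 6 → k) :
    hessian (segreForm k) x v w = 6 * ((x * v) ⬝ᵥ w) := by
  have hsecond (i j : Fin 6) :
      MvPolynomial.eval x (MvPolynomial.pderiv j (MvPolynomial.pderiv i (segreForm k))) =
        if i = j then 6 * x i else 0 := by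
    rw [pderiv_segreForm, MvPolynomial.pderiv_C_mul, Derivation.leibniz_pow, MvPolynomial.pderiv_X]
    rcases eq_or_ne i j with rfl | hij
    · simp only [Pi.single_eq_same, map_mul, map_pow, MvPolynomial.eval_C, MvPolynomial.eval_X,
        smul_eq_mul, nsmul_eq_mul, mul_one, map_natCast, if_true]
      push_cast
      ring
    · simp [hij]
  simp only [hessian, hsecond, mul_ite, mul_zero, Finset.sum_ite_eq, Finset.mem_univ, if_true,
    dotProduct, Pi.mul_apply, Finset.mul_sum]
  exact Finset.sum_congr rfl fun i _ => by ring

theorem segreForm_isHomogeneous : (segreForm k).IsHomogeneous 3 :=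
  MvPolynomial.IsHomogeneous.sum _ _ _ fun i _ => MvPolynomial.isHomogeneous_X_pow i 3

theorem hessian_segreForm_eq_polarization (x v w : Fin 6 → k) :
    hessian (segreForm k) x v w =
      MvPolynomial.eval (x + v + w) (segreForm k) - MvPolynomial.eval (x + v) (segreForm k) -
        MvPolynomial.eval (x + w) (segreForm k) - MvPolynomial.eval (v + w) (segreForm k) +
        MvPolynomial.eval x (segreForm k) + MvPolynomial.eval v (segreForm k) +
        MvPolynomial.eval w (segreForm k) := by
  simp only [hessian_segreForm, eval_segreForm, dotProduct, Finset.mul_sum,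
    ← Finset.sum_add_distrib, ← Finset.sum_sub_distrib, Pi.add_apply, Pi.mul_apply]
  exact Finset.sum_congr rfl fun i _ => by ring

theorem exists_eval_segreForm_ne_zero (hL : 1 < Module.finrank k L) (hx : x ∈ L)
    (hnode : IsNondegenerateVector (segreForm k) L x) :
    ∃ y ∈ L, MvPolynomial.eval y (segreForm k) ≠ 0 := by
  by_contra! hzero
  have hle : L ≤ Submodule.span k {x} := fun v hv => hnode v hv fun w hw => by
    have hsum : x + v + w ∈ L := add_mem (add_mem hx hv) hw
    simp [hessian_segreForm_eq_polarization, hzero, hsum, add_mem, hx, hv, hw]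
  have hrank := (Submodule.finrank_mono hle).trans (finrank_span_le_card _)
  rw [Set.toFinset_singleton, Finset.card_singleton] at hrank
  omega

theorem finrank_Wdual : Module.finrank k (Wdual k) = 5 := by
  have hker : Wdual k = LinearMap.ker (dotProductBilin k k (1 : Fin 6 → k)) := by
    ext x
    simp [mem_Wdual, one_dotProduct]
  have hne : dotProductBilin k k (1 : Fin 6 → k) ≠ 0 := fun h =>
    one_ne_zero (α := k) (by simpa using LinearMap.congr_fun h (Pi.single 0 1))
  have hrank := Module.Dual.finrank_ker_add_one_of_ne_zero (f := dotProductBilin k k 1) hne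
  rw [← hker, Module.finrank_fin_fun] at hrank
  omega

theorem finrank_hyperplane (h : ℙ k (Module.Dual k (Wdual k))) :
    Module.finrank k (hyperplane h) = 4 := by
  have hrank := Module.Dual.finrank_ker_add_one_of_ne_zero h.rep_nonzero
  rw [finrank_Wdual] at hrank
  rw [hyperplane, Submodule.finrank_map_subtype_eq]
  omega

variable [CharZero k]

theorem isSingularVector_segreForm_iff (hx : x ∈ sectionSpace a) :
    IsSingularVector (segreForm k) (sectionSpace a) x ↔ x ^ 2 ∈ affineValues a := by
  simp only [IsSingularVector, eval_segreForm, dirDeriv_segreForm, mul_eq_zero,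
    OfNat.ofNat_ne_zero, false_or, ← mem_affineValues_iff_forall_dotProduct_eq_zero]
  exact and_iff_right_of_imp (sum_pow_three_eq_zero_of_sq_mem hx)

theorem isNondegenerateVector_segreForm_iff :
    IsNondegenerateVector (segreForm k) (sectionSpace a) x ↔
      ∀ v ∈ sectionSpace a, x * v ∈ affineValues a → v ∈ Submodule.span k {x} := by
  simp only [IsNondegenerateVector, hessian_segreForm, mul_eq_zero, OfNat.ofNat_ne_zero, false_or,
    mem_affineValues_iff_forall_dotProduct_eq_zero]

theorem existsUnique_node_segreForm_iff :
    (∃ p : ℙ k (sectionSpace a), IsNodeAt (segreForm k) (sectionSpace a) p ∧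
        ∀ q, IsSingularAt (segreForm k) (sectionSpace a) q → q = p) ↔
      ∃ y, IsUniqueNodalVector a y := by
  rw [existsUnique_node_iff segreForm_isHomogeneous]
  constructor
  · rintro ⟨y, hy, hy0, ⟨hsing, hnode⟩, hunique⟩
    exact ⟨y, hy0, hy, (isSingularVector_segreForm_iff hy).1 hsing,
      isNondegenerateVector_segreForm_iff.1 hnode,
      fun z hz hz2 => hunique z hz ((isSingularVector_segreForm_iff hz).2 hz2)⟩
  · rintro ⟨y, h⟩
    exact ⟨y, h.mem_sectionSpace, h.ne_zero,
      ⟨(isSingularVector_segreForm_iff h.mem_sectionSpace).2 h.sq_mem,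
        isNondegenerateVector_segreForm_iff.2 h.mem_span_of_mul_mem⟩,
      fun z hz hsing => h.mem_span_of_sq_mem z hz ((isSingularVector_segreForm_iff hz).1 hsing)⟩

variable (h : ℙ k (Module.Dual k (Wdual k)))

theorem hyperplane_eq_sectionSpace : hyperplane h = sectionSpace (dualCoord h.rep) := by
  ext x
  simp only [hyperplane, Submodule.mem_map, LinearMap.mem_ker, apply_eq_sum_dualCoord,
    mem_sectionSpace]
  constructor
  · rintro ⟨y, hy, rfl⟩
    exact ⟨y.2, hy⟩
  · rintro ⟨hsum, hdot⟩
    exact ⟨⟨x, hsum⟩, hdot, rfl⟩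

theorem dualCoord_rep_ne_zero : dualCoord h.rep ≠ 0 := by
  intro hzero
  refine h.rep_nonzero (LinearMap.ext fun x => ?_)
  simp [apply_eq_sum_dualCoord, hzero]

theorem isOneNodalCubicSurface_iff :
    IsOneNodalCubicSurface (segreForm k) (hyperplane h) ↔
      ∃ y, IsUniqueNodalVector (dualCoord h.rep) y := by
  have hrank := finrank_hyperplane h
  rw [hyperplane_eq_sectionSpace] at hrank ⊢
  rw [← existsUnique_node_segreForm_iff]
  refine ⟨fun hsurface => hsurface.existsUnique_node, fun hnode => ?_⟩
  obtain ⟨y, hy⟩ := existsUnique_node_segreForm_iff.1 hnode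
  exact ⟨hrank, segreForm_isHomogeneous, exists_eval_segreForm_ne_zero (by omega)
    hy.mem_sectionSpace (isNondegenerateVector_segreForm_iff.2 hy.mem_span_of_mul_mem), hnode⟩

end HyperplaneSection

section Loci

variable {k : Type*} [Field k] [CharZero k] {h : ℙ k (Module.Dual k (Wdual k))}

theorem mem_dualHyperplane_mk {x : Wdual k} (hx : x ≠ 0) :
    h ∈ dualHyperplane (Projectivization.mk k x hx) ↔ dualCoord h.rep ⬝ᵥ x = 0 := by
  obtain ⟨c, hc⟩ := Projectivization.exists_smul_eq_mk_rep k x hx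
  rw [dotProduct, ← apply_eq_sum_dualCoord, dualHyperplane, Set.mem_ofPred_eq, ← hc,
    Units.smul_def, map_smul, smul_eq_mul, mul_eq_zero, or_iff_right c.ne_zero]

theorem mem_castelnuovoRichmondQuartic :
    h ∈ castelnuovoRichmondQuartic k ↔ castelnuovoRichmondForm (dualCoord h.rep) = 0 :=
  Iff.rfl

theorem exists_node_mem_dualHyperplane_sdiff_iff :
    (∃ p ∈ nodes k, h ∈ dualHyperplane p \
        (castelnuovoRichmondQuartic k ∪ ⋃ q ∈ nodes k \ {p}, dualHyperplane q)) ↔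
      ∃ σ, dualCoord h.rep ⬝ᵥ nodeVector k σ = 0 ∧
        castelnuovoRichmondForm (dualCoord h.rep) ≠ 0 ∧
        ∀ τ, dualCoord h.rep ⬝ᵥ nodeVector k τ = 0 →
          (nodeVector k τ : Fin 6 → k) ∈ Submodule.span k {(nodeVector k σ : Fin 6 → k)} := by
  simp only [nodes, Set.exists_range_iff, Set.mem_sdiff, Set.mem_union, Set.mem_iUnion,
    mem_dualHyperplane_mk, mem_castelnuovoRichmondQuartic, not_or, exists_prop, not_exists, not_and,
    and_imp, Set.forall_mem_range, Set.mem_singleton_iff,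
    ProjHypersurface.mk_eq_mk_iff_mem_span, not_imp_not]

theorem mem_castelnuovoRichmondQuartic_sdiff_iff :
    h ∈ castelnuovoRichmondQuartic k \ ⋃ p ∈ nodes k, dualHyperplane p ↔
      castelnuovoRichmondForm (dualCoord h.rep) = 0 ∧
        ∀ σ, dualCoord h.rep ⬝ᵥ nodeVector k σ ≠ 0 := by
  simp [nodes, mem_dualHyperplane_mk, mem_castelnuovoRichmondQuartic]

end Loci

end SegreCubic

theorem mainTheorem10_general {k : Type*} [Field k] [CharZero k]
    (h : ℙ k (Module.Dual k (SegreCubic.Wdual k))) :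
    ProjHypersurface.IsOneNodalCubicSurface (SegreCubic.segreForm k) (SegreCubic.hyperplane h) ↔
      (∃ p ∈ SegreCubic.nodes k,
        h ∈ SegreCubic.dualHyperplane p \
          (SegreCubic.castelnuovoRichmondQuartic k ∪
            ⋃ q ∈ SegreCubic.nodes k \ {p}, SegreCubic.dualHyperplane q)) ∨
      h ∈ SegreCubic.castelnuovoRichmondQuartic k \
        ⋃ p ∈ SegreCubic.nodes k, SegreCubic.dualHyperplane p := by
  rw [SegreCubic.isOneNodalCubicSurface_iff,
    SegreCubic.exists_isUniqueNodalVector_iff (SegreCubic.sum_dualCoord h.rep)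
      (SegreCubic.dualCoord_rep_ne_zero h),
    SegreCubic.exists_node_mem_dualHyperplane_sdiff_iff,
    SegreCubic.mem_castelnuovoRichmondQuartic_sdiff_iff]

theorem mainTheorem10 {k : Type*} [Field k] [IsAlgClosed k] [CharZero k]
    (h : ℙ k (Module.Dual k (SegreCubic.Wdual k))) :
    ProjHypersurface.IsOneNodalCubicSurface (SegreCubic.segreForm k) (SegreCubic.hyperplane h) ↔
      (∃ p ∈ SegreCubic.nodes k,
        h ∈ SegreCubic.dualHyperplane p \
          (SegreCubic.castelnuovoRichmondQuartic k ∪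
            ⋃ q ∈ SegreCubic.nodes k \ {p}, SegreCubic.dualHyperplane q)) ∨
      h ∈ SegreCubic.castelnuovoRichmondQuartic k \
        ⋃ p ∈ SegreCubic.nodes k, SegreCubic.dualHyperplane p :=
  mainTheorem10_general h
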